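/- A hypergraph $h=(I,E)$ consists of a finite set $I$ of nodes and a finite multiset $E$ of non-empty subsets of $I$, called hyperedges (repeated hyperedges and one-element hyperedges are allowed). A heading of $h$ is a map $\sigma\colon E\to I$ with $\sigma(e)\in e$ for every $e\in E$ (copies of the same hyperedge are treated as different elements of $E$); $\sigma(e)$ is called the head of $e$. A heading is acyclic if there is no sequence $e_1,\dots,e_\ell$ $(\ell\ge 1)$ of hyperedges with $\sigma(e_k)\in e_{k+1}\setminus\{\sigma(e_{k+1})\}$ for all $k=1,\dots,\ell$, where $e_{\ell+1}=e_1$. An $m$-coloring of $h$ is a map $c\colon I\to[m]=\{1,\dots,m\}$. It is proper if every hyperedge $e$ contains exactly one node $i$ with $c(i)=\max_{j\in e}c(j)$. A heading $\sigma$ and an $m$-coloring $c$ (not necessarily proper) are compatible if $c(\sigma(e))=\max_{j\in e}c(j)$ for every $e\in E$. Theorem. Let $h=(I,E)$ be a hypergraph with $d=|I|$ nodes. There is a unique polynomial $\chi_d(h)\in\mathbb{Q}[x]$ such that, for every positive integer $m$, $\chi_d(h)(m)$ is the number of proper $m$-colorings of $h$. For every positive integer $m$, $$(-1)^d\,\chi_d(h)(-m)=\#\{(\sigma,c)\;:\;\sigma\text{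 an acyclic heading of }h,\ c\text{ an } m\text{-coloring of }h,\ \sigma\text{ and }c\text{ compatible}\}.$$ In particular, $(-1)^d\,\chi_d(h)(-1)$ is the number of acyclic headings of $h$. -/

import Mathlib

open Polynomial

/-- A hypergraph on the node set `I`: a finite multiset of non-empty subsets of `I`, the hyperedges.
Repeated hyperedges and hyperedges with a single node are allowed. -/
structure MultiHypergraph (I : Type*) where
  /-- The multiset of hyperedges. -/
  edges : Multiset (Finset I)
  /-- Hyperedges are non-empty. -/
  nonempty_of_mem : ∀ e ∈ edges, e.Nonempty

namespace MultiHypergraph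

/-- The type of hyperedges of `h` counted with multiplicity; the underlying set of nodes
of `e : h.Edge` is `e.1`. -/
abbrev Edge {I : Type*} [DecidableEq I] (h : MultiHypergraph I) : Type _ :=
  h.edges.ToType

/-- A heading of `h` picks for every hyperedge (each copy separately) a node of that hyperedge,
its head. -/
def Heading {I : Type*} [DecidableEq I] (h : MultiHypergraph I) : Type _ :=
  {σ : h.Edge → I // ∀ e : h.Edge, σ e ∈ e.1}

namespace Heading

/-- The head of a hyperedge. -/
def head {I : Type*} [DecidableEq I] {h : MultiHypergraph I} (σ : h.Heading) (e : h.Edge) : I :=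
  σ.1 e

/-- The sequence `e 0, …, e n` of hyperedges is an oriented cycle of `σ`: the head of each
hyperedge is a node, different from the head, of the cyclically next one (the addition `i + 1`
is taken in `Fin (n + 1)`, so it is cyclic). -/
def IsOrientedCycle {I : Type*} [DecidableEq I] {h : MultiHypergraph I} (σ : h.Heading)
    {n : ℕ} (e : Fin (n + 1) → h.Edge) : Prop :=
  ∀ i : Fin (n + 1), σ.head (e i) ∈ (e (i + 1)).1 \ {σ.head (e (i + 1))}

/-- A heading is acyclic if it has no oriented cycle (of any length at least one). -/
def IsAcyclic {I : Type*} [DecidableEq I] {h : MultiHypergraph I} (σ : h.Heading) : Prop :=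
  ¬ ∃ (n : ℕ) (e : Fin (n + 1) → h.Edge), σ.IsOrientedCycle e

end Heading

/-- The node `i` of the hyperedge `e` has maximal color among the nodes of `e`. -/
def IsMaximalNode {I : Type*} {m : ℕ} (c : I → Fin m) (e : Finset I) (i : I) : Prop :=
  i ∈ e ∧ ∀ j ∈ e, c j ≤ c i

/-- A coloring with `m` colors is proper if every hyperedge has a unique maximal node. -/
def IsProperColoring {I : Type*} (h : MultiHypergraph I) {m : ℕ} (c : I → Fin m) : Prop :=
  ∀ e ∈ h.edges, ∃! i : I, IsMaximalNode c e i

/-- A heading and a coloring are compatible if the head of each hyperedge has maximal color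
in that hyperedge. -/
def Compatible {I : Type*} [DecidableEq I] {h : MultiHypergraph I} {m : ℕ}
    (σ : h.Heading) (c : I → Fin m) : Prop :=
  ∀ e : h.Edge, IsMaximalNode c e.1 (σ.head e)

/-- `χ` is the coloring polynomial of `h`: for every positive integer `m`, the value `χ(m)` is the
number of proper colorings of `h` with `m` colors. -/
def IsColoringPolynomial {I : Type*} (h : MultiHypergraph I) (χ : ℚ[X]) : Prop :=
  ∀ m : ℕ, 0 < m → χ.eval (m : ℚ) = (Nat.card {c : I → Fin m // h.IsProperColoring c} : ℚ)

end MultiHypergraph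

/-!
Say that `i` lies below `j` if `i` is a node of a hyperedge with head `j ≠ i`. This turns a
heading into a relation on the nodes, acyclic iff it is well-founded. A proper coloring is
strictly increasing for exactly one heading, the one that selects the maximal nodes, and a
coloring is compatible with a heading iff it is weakly increasing. So `χ` is a sum of order
polynomials and the theorem reduces to Stanley's reciprocity between strict and weak labelings of
a finite well-founded relation.

Reciprocity holds because both counts satisfy one recursion over sets `U` of minimal elements. A
strict labeling by `m + 1` labels is a strict labeling by `m` labels of the complement of its
zero set `U`; by inclusion-exclusion, weak labelings satisfy the same recursion, up to signs, with
`m` replaced by `-(m + 1)`. Summing this difference equation gives one polynomial that takes the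
strict counts at the natural numbers and the signed weak counts at their negatives.
-/

section DifferenceEquation

variable {K : Type*} [CommRing K] [Algebra ℚ K]

theorem exists_taylor_one_eq_add (Q : K[X]) : ∃ P : K[X], taylor 1 P = P + Q := by
  induction Q using Polynomial.induction_on' with
  | add Q₁ Q₂ h₁ h₂ =>
    obtain ⟨P₁, h₁⟩ := h₁
    obtain ⟨P₂, h₂⟩ := h₂
    exact ⟨P₁ + P₂, by rw [map_add, h₁, h₂, add_add_add_comm]⟩
  | monomial n a =>
    let B : ℚ[X] := C (n + 1 : ℚ)⁻¹ * Polynomial.bernoulli (n + 1)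
    have taylor_B : taylor 1 B = B + X ^ n := by
      have hn : (n + 1 : ℚ)⁻¹ * (n + 1) = 1 := inv_mul_cancel₀ n.cast_add_one_ne_zero
      rw [taylor_mul, taylor_C, taylor_apply, C_1, add_comm X, bernoulli_comp_one_add_X, mul_add,
        add_tsub_cancel_right, nsmul_eq_mul, ← mul_assoc, ← C_eq_natCast, ← C_mul,
        Nat.cast_succ, hn, C_1, one_mul]
    refine ⟨C a * B.map (algebraMap ℚ K), ?_⟩
    rw [taylor_mul, taylor_C, ← map_one (algebraMap ℚ K), ← map_taylor, taylor_B,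
      Polynomial.map_add, Polynomial.map_pow, map_X, mul_add, C_mul_X_pow_eq_monomial]

theorem exists_eval_natCast_eq_and_eval_neg_natCast_eq (Q : K[X]) {f g : ℕ → K} (h₀ : f 0 = g 0)
    (hf : ∀ m : ℕ, f (m + 1) = f m + Q.eval (m : K))
    (hg : ∀ m : ℕ, g m = g (m + 1) + Q.eval (-((m + 1 : ℕ) : K))) :
    ∃ P : K[X], ∀ m : ℕ, P.eval (m : K) = f m ∧ P.eval (-(m : K)) = g m := by
  obtain ⟨P, hP⟩ := exists_taylor_one_eq_add Q
  have eval_add_one (x : K) : P.eval (x + 1) = P.eval x + Q.eval x := by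
    rw [← taylor_eval, hP, eval_add]
  refine ⟨P + C (f 0 - P.eval 0), fun m => ?_⟩
  simp only [eval_add, eval_C]
  induction m with
  | zero => simp [h₀]
  | succ m ih =>
    constructor
    · rw [hf, ← ih.1, Nat.cast_succ, eval_add_one]
      ring
    · have step := eval_add_one (-((m + 1 : ℕ) : K))
      rw [show -((m + 1 : ℕ) : K) + 1 = -(m : K) by push_cast; ring] at step
      linear_combination ih.2 - step + hg m

end DifferenceEquation

theorem exists_cyclic_iff_not_wellFounded {α : Type*} [Finite α] {r : α → α → Prop} :
    (∃ (n : ℕ) (f : Fin (n + 1) → α), ∀ i, r (f i) (f (i + 1))) ↔ ¬ WellFounded r := by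
  constructor
  · rintro ⟨n, f, hf⟩ hr
    obtain ⟨_, ⟨i, rfl⟩, hmin⟩ := hr.has_min (Set.range f) (Set.range_nonempty f)
    exact hmin _ ⟨i - 1, rfl⟩ (by simpa using hf (i - 1))
  · intro hr
    obtain ⟨⟨f, hf⟩⟩ := not_isEmpty_iff.1 (wellFounded_iff_isEmpty_descending_chain.not.1 hr)
    obtain ⟨a, b, hab, heq⟩ : ∃ a b, a < b ∧ f a = f b := by
      simpa using Set.finite_univ.exists_lt_map_eq_of_forall_mem (f := f) fun n => Set.mem_univ _
    obtain ⟨n, rfl⟩ := Nat.exists_eq_add_of_lt hab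
    refine ⟨n, fun i => f (a + (n - i)), fun i => ?_⟩
    rcases eq_or_ne i (Fin.last n) with rfl | hi
    · simpa [heq] using hf (a + n)
    · have hi' := Fin.val_lt_last hi
      have hval : ((i + 1 : Fin (n + 1)) : ℕ) = i + 1 := by rw [Fin.val_add_one, if_neg hi]
      have hindex : a + (n - i) = a + (n - (i + 1)) + 1 := by omega
      simpa only [hval, hindex] using hf (a + (n - (i + 1)))

section Reciprocity

open Finset

variable {α : Type*}

/-- Labelings of `α` by `m` labels that are strictly increasing along `r`. When `r` is a finite
strict order, their number is the strict order polynomial of `r` at `m`. -/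
abbrev StrictLabeling (r : α → α → Prop) (m : ℕ) : Type _ :=
  r →r ((· < ·) : Fin m → Fin m → Prop)

/-- Labelings of `α` by `m` labels that are weakly increasing along `r`, counted by the weak order
polynomial when `r` is a finite strict order. -/
abbrev WeakLabeling (r : α → α → Prop) (m : ℕ) : Type _ :=
  r →r ((· ≤ ·) : Fin m → Fin m → Prop)

instance {β : Type*} [Finite α] [Finite β] (r : α → α → Prop) (s : β → β → Prop) :
    Finite (r →r s) :=
  DFunLike.finite _

open Classical in
/-- The elements of `α` without `r`-predecessor. They are the only ones on which a strict labeling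
can take its least label. -/
noncomputable def minimalElements [Fintype α] (r : α → α → Prop) : Finset α :=
  {i | ∀ j, ¬ r j i}

variable {r : α → α → Prop}

theorem mem_minimalElements [Fintype α] {i : α} : i ∈ minimalElements r ↔ ∀ j, ¬ r j i := by
  simp [minimalElements]

theorem notMem_of_rel_of_subset_minimalElements [Fintype α] {U : Finset α}
    (hU : U ⊆ minimalElements r) {i j : α} (hij : r i j) : j ∉ U :=
  fun hj => mem_minimalElements.1 (hU hj) i hij

theorem card_subrel_notMem_empty_relHom {β : Type*} (s : β → β → Prop) :
    Nat.card (Subrel r (· ∉ (∅ : Finset α)) →r s) = Nat.card (r →r s) :=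
  Nat.card_congr
    { toFun c := ⟨fun i => c ⟨i, notMem_empty i⟩, fun hij => c.map_rel hij⟩
      invFun c := ⟨fun i => c i, fun hij => c.map_rel hij⟩
      left_inv _ := rfl
      right_inv _ := rfl }

variable {m : ℕ}

/-- A strict labeling with zero set `U` is a strict labeling of the complement of `U` with the
labels shifted by one. -/
def StrictLabeling.zeroSetEquiv [Fintype α] [DecidableEq α] {U : Finset α}
    (hU : U ⊆ minimalElements r) :
    {c : StrictLabeling r (m + 1) // ∀ i, c i = 0 ↔ i ∈ U} ≃
      StrictLabeling (Subrel r (· ∉ U)) m where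
  toFun c := ⟨fun i => (c.1 i).pred ((c.2 i).not.2 i.2), fun hij =>
    Fin.pred_lt_pred_iff.2 (c.1.map_rel hij)⟩
  invFun d := ⟨⟨fun i => if hi : i ∈ U then 0 else (d ⟨i, hi⟩).succ, fun {i j} hij => by
      have hj := notMem_of_rel_of_subset_minimalElements hU hij
      by_cases hi : i ∈ U
      · simp [hi, hj]
      · simpa [hi, hj] using d.map_rel (a := ⟨i, hi⟩) (b := ⟨j, hj⟩) hij⟩,
    fun i => by by_cases hi : i ∈ U <;> simp [hi]⟩
  left_inv c := by
    ext i
    by_cases hi : i ∈ U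
    · simp [hi, (c.2 i).2 hi]
    · simp [hi]
  right_inv d := by
    ext i
    simp [i.2]

/-- A weak labeling that vanishes on a set `U` of minimal elements is an arbitrary weak labeling of
the complement of `U`. -/
def WeakLabeling.vanishingEquiv [Fintype α] [DecidableEq α] {U : Finset α}
    (hU : U ⊆ minimalElements r) :
    {c : WeakLabeling r (m + 1) // ∀ i ∈ U, c i = 0} ≃
      WeakLabeling (Subrel r (· ∉ U)) (m + 1) where
  toFun c := ⟨fun i => c.1 i, fun hij => c.1.map_rel hij⟩
  invFun d := ⟨⟨fun i => if hi : i ∈ U then 0 else d ⟨i, hi⟩, fun {i j} hij => by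
      have hj := notMem_of_rel_of_subset_minimalElements hU hij
      by_cases hi : i ∈ U
      · simp [hi]
      · simpa [hi, hj] using d.map_rel (a := ⟨i, hi⟩) (b := ⟨j, hj⟩) hij⟩,
    fun i hi => by simp [hi]⟩
  left_inv c := by
    ext i
    by_cases hi : i ∈ U
    · simp [hi, c.2 i hi]
    · simp [hi]
  right_inv d := by
    ext i
    simp [i.2]

theorem WeakLabeling.ne_zero_of_forall_minimalElements_ne_zero [Fintype α] (hr : WellFounded r)
    (c : WeakLabeling r (m + 1)) (hc : ∀ i ∈ minimalElements r, c i ≠ 0) (i : α) : c i ≠ 0 := by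
  induction i using hr.induction with
  | _ i ih =>
    by_cases hi : i ∈ minimalElements r
    · exact hc i hi
    · obtain ⟨j, hji⟩ : ∃ j, r j i := by simpa [mem_minimalElements] using hi
      have hle : c j ≤ c i := c.map_rel hji
      exact ((Fin.pos_iff_ne_zero.2 (ih j hji)).trans_le hle).ne'

/-- Shifting the labels by one turns weak labelings by `m` labels into the weak labelings by
`m + 1` labels that do not vanish on minimal elements. -/
def WeakLabeling.succEquiv [Fintype α] (hr : WellFounded r) :
    WeakLabeling r m ≃ {c : WeakLabeling r (m + 1) // ∀ i ∈ minimalElements r, c i ≠ 0} where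
  toFun c := ⟨⟨fun i => (c i).succ, fun hij => Fin.succ_le_succ_iff.2 (c.map_rel hij)⟩,
    fun i _ => Fin.succ_ne_zero (c i)⟩
  invFun c := ⟨fun i => (c.1 i).pred (ne_zero_of_forall_minimalElements_ne_zero hr c.1 c.2 i),
    fun hij => Fin.pred_le_pred_iff.2 (c.1.map_rel hij)⟩
  left_inv c := by
    ext i
    simp
  right_inv c := by
    ext i
    simp

theorem card_strictLabeling_succ [Fintype α] (r : α → α → Prop) (m : ℕ) :
    Nat.card (StrictLabeling r (m + 1)) =
      ∑ U ∈ (minimalElements r).powerset, Nat.card (StrictLabeling (Subrel r (· ∉ U)) m) := by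
  classical
  have := Fintype.ofFinite (StrictLabeling r (m + 1))
  let zeroSet (c : StrictLabeling r (m + 1)) : Finset α := {i | c i = 0}
  have zeroSet_mem (c : StrictLabeling r (m + 1)) :
      zeroSet c ∈ (minimalElements r).powerset := by
    refine mem_powerset.2 fun i hi => mem_minimalElements.2 fun j hji => ?_
    have hlt : c j < c i := c.map_rel hji
    simp_all [zeroSet]
  rw [Nat.card_eq_fintype_card, ← card_univ,
    card_eq_sum_card_fiberwise fun c _ => zeroSet_mem c]
  refine sum_congr rfl fun U hU => ?_
  rw [← Nat.card_congr (StrictLabeling.zeroSetEquiv (mem_powerset.1 hU)),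
    Nat.card_eq_fintype_card, Fintype.card_subtype]
  congr! 2 with c
  simp [zeroSet, Finset.ext_iff]

theorem card_weakLabeling_eq_sum [Fintype α] (hr : WellFounded r) (m : ℕ) :
    (Nat.card (WeakLabeling r m) : ℤ) = ∑ U ∈ (minimalElements r).powerset,
      (-1) ^ #U * (Nat.card (WeakLabeling (Subrel r (· ∉ U)) (m + 1)) : ℤ) := by
  classical
  have := Fintype.ofFinite (WeakLabeling r (m + 1))
  let vanishing (i : α) : Finset (WeakLabeling r (m + 1)) := {c | c i = 0}
  have card_compl :
      Nat.card (WeakLabeling r m) = #((minimalElements r).inf fun i => (vanishing i)ᶜ) := by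
    rw [Nat.card_congr (WeakLabeling.succEquiv hr), Nat.card_eq_fintype_card,
      Fintype.card_subtype]
    congr 1
    ext c
    simp [vanishing, mem_inf]
  have card_inf {U : Finset α} (hU : U ⊆ minimalElements r) :
      Nat.card (WeakLabeling (Subrel r (· ∉ U)) (m + 1)) = #(U.inf vanishing) := by
    rw [← Nat.card_congr (WeakLabeling.vanishingEquiv hU), Nat.card_eq_fintype_card,
      Fintype.card_subtype]
    congr 1
    ext c
    simp [vanishing, mem_inf]
  rw [card_compl, inclusion_exclusion_card_inf_compl]
  exact sum_congr rfl fun U hU => by rw [card_inf (mem_powerset.1 hU)]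

theorem signed_card_weakLabeling_eq_sum [Fintype α] (hr : WellFounded r) (m : ℕ) :
    (-1 : ℚ) ^ Nat.card α * Nat.card (WeakLabeling r m) = ∑ U ∈ (minimalElements r).powerset,
      (-1) ^ Nat.card {i // i ∉ U} * (Nat.card (WeakLabeling (Subrel r (· ∉ U)) (m + 1)) : ℚ) := by
  classical
  have sign (U : Finset α) : (-1 : ℚ) ^ Nat.card α * (-1) ^ #U = (-1) ^ Nat.card {i // i ∉ U} := by
    have card_eq : Nat.card α = Nat.card {i // i ∉ U} + #U := by
      rw [Nat.card_eq_fintype_card, Nat.card_eq_fintype_card, Fintype.card_subtype_compl,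
        Fintype.card_coe, Nat.sub_add_cancel U.card_le_univ]
    rw [card_eq, pow_add, mul_assoc, ← mul_pow]
    simp
  rw [← Int.cast_natCast (Nat.card (WeakLabeling r m)), card_weakLabeling_eq_sum hr,
    Int.cast_sum, mul_sum]
  refine sum_congr rfl fun U _ => ?_
  rw [← sign U]
  push_cast
  ring

theorem card_strictLabeling_zero_eq_signed_card_weakLabeling_zero (r : α → α → Prop) :
    (Nat.card (StrictLabeling r 0) : ℚ) = (-1) ^ Nat.card α * Nat.card (WeakLabeling r 0) := by
  rcases isEmpty_or_nonempty α with hα | hα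
  · rw [Nat.card_of_isEmpty (α := α), pow_zero, one_mul, Nat.card_congr]
    exact
      { toFun c := ⟨c, fun {i} => isEmptyElim i⟩
        invFun c := ⟨c, fun {i} => isEmptyElim i⟩
        left_inv _ := rfl
        right_inv _ := rfl }
  · have : IsEmpty (StrictLabeling r 0) := ⟨fun c => (c (Classical.arbitrary α)).elim0⟩
    have : IsEmpty (WeakLabeling r 0) := ⟨fun c => (c (Classical.arbitrary α)).elim0⟩
    simp

theorem exists_orderPolynomial_reciprocity [Finite α] (hr : WellFounded r) :
    ∃ P : ℚ[X], ∀ m : ℕ, P.eval (m : ℚ) = Nat.card (StrictLabeling r m) ∧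
      P.eval (-(m : ℚ)) = (-1) ^ Nat.card α * Nat.card (WeakLabeling r m) := by
  classical
  induction hn : Nat.card α using Nat.strong_induction_on generalizing α with
  | _ n ih =>
    subst hn
    have := Fintype.ofFinite α
    have ih' (U : Finset α) (hU : U ≠ ∅) : ∃ P : ℚ[X], ∀ m : ℕ,
        P.eval (m : ℚ) = Nat.card (StrictLabeling (Subrel r (· ∉ U)) m) ∧
        P.eval (-(m : ℚ)) =
          (-1) ^ Nat.card {i // i ∉ U} * Nat.card (WeakLabeling (Subrel r (· ∉ U)) m) := by
      refine ih _ ?_ (InvImage.wf Subtype.val hr) rfl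
      obtain ⟨i, hi⟩ := nonempty_iff_ne_empty.2 hU
      exact Finite.card_subtype_lt (x := i) (by simpa using hi)
    choose! P hP using ih'
    have split_empty (F : Finset α → ℚ) : ∑ U ∈ (minimalElements r).powerset, F U =
        F ∅ + ∑ U ∈ (minimalElements r).powerset.erase ∅, F U :=
      (add_sum_erase _ F (empty_mem_powerset _)).symm
    refine exists_eval_natCast_eq_and_eval_neg_natCast_eq
      (∑ U ∈ (minimalElements r).powerset.erase ∅, P U)
      (card_strictLabeling_zero_eq_signed_card_weakLabeling_zero r) (fun m => ?_) fun m => ?_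
    · rw [card_strictLabeling_succ, Nat.cast_sum, split_empty, card_subrel_notMem_empty_relHom,
        eval_finsetSum]
      exact congrArg _ (sum_congr rfl fun U hU => ((hP U (ne_of_mem_erase hU) m).1).symm)
    · rw [signed_card_weakLabeling_eq_sum hr, split_empty, card_subrel_notMem_empty_relHom,
        eval_finsetSum]
      refine congrArg₂ _ (by simp) (sum_congr rfl fun U hU => ?_)
      exact ((hP U (ne_of_mem_erase hU) (m + 1)).2).symm

end Reciprocity

namespace MultiHypergraph

open Finset

variable {I : Type*}

theorem IsColoringPolynomial.eq {h : MultiHypergraph I} {χ χ' : ℚ[X]}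
    (hχ : h.IsColoringPolynomial χ) (hχ' : h.IsColoringPolynomial χ') : χ = χ' := by
  refine eq_of_infinite_eval_eq _ _ ((Set.infinite_range_of_injective
    (Nat.cast_injective.comp Nat.succ_injective)).mono ?_)
  rintro _ ⟨n, rfl⟩
  exact (hχ _ n.succ_pos).trans (hχ' _ n.succ_pos).symm

variable [DecidableEq I] {h : MultiHypergraph I}

instance : Finite h.Heading :=
  Finite.of_injective (β := ∀ e : h.Edge, {i // i ∈ e.1}) (fun σ e => ⟨σ.1 e, σ.2 e⟩)
    fun _ _ heq => Subtype.ext <| funext fun e => congrArg Subtype.val (congrFun heq e)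

namespace Heading

/-- The relation on nodes induced by a heading: `i` is below `j` if some hyperedge with head `j`
contains `i` as a node other than the head. -/
def Below (σ : h.Heading) (i j : I) : Prop :=
  ∃ e : h.Edge, σ.head e = j ∧ i ∈ e.1 \ {j}

variable {σ : h.Heading}

theorem isAcyclic_iff_wellFounded_edge :
    σ.IsAcyclic ↔ WellFounded fun e e' : h.Edge => σ.head e ∈ e'.1 \ {σ.head e'} :=
  not_iff_comm.1 exists_cyclic_iff_not_wellFounded.symm

theorem isAcyclic_iff_wellFounded_below : σ.IsAcyclic ↔ WellFounded σ.Below := by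
  rw [isAcyclic_iff_wellFounded_edge]
  refine ⟨fun hσ => ?_, fun hσ => (InvImage.wf σ.head hσ).mono ?_⟩
  · -- Distinct hyperedges may share a head, so the induction runs over hyperedges, not heads.
    have acc_of_mem (e : h.Edge) : ∀ i ∈ e.1 \ {σ.head e}, Acc σ.Below i := by
      induction e using hσ.induction with
      | _ e ih =>
        refine fun i hi => ⟨i, ?_⟩
        rintro k ⟨e', rfl, hk⟩
        exact ih e' hi k hk
    refine ⟨fun j => ⟨j, ?_⟩⟩
    rintro i ⟨e, rfl, hi⟩
    exact acc_of_mem e i hi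
  · exact fun e e' he => ⟨e', rfl, he⟩

variable {m : ℕ} {c : I → Fin m}

theorem isAcyclic_of_strictLabeling (c : StrictLabeling σ.Below m) : σ.IsAcyclic :=
  isAcyclic_iff_wellFounded_below.2 (RelHomClass.wellFounded c wellFounded_lt)

theorem compatible_iff_forall_below_le :
    Compatible σ c ↔ ∀ ⦃i j⦄, σ.Below i j → c i ≤ c j := by
  constructor
  · rintro hc i _ ⟨e, rfl, hi⟩
    exact (hc e).2 i (mem_sdiff.1 hi).1
  · refine fun hc e => ⟨σ.2 e, fun i hi => ?_⟩
    rcases eq_or_ne i (σ.head e) with rfl | hne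
    · rfl
    · exact hc ⟨e, rfl, by simp [hi, hne]⟩

theorem forall_below_lt_iff_isMaximalNode_iff :
    (∀ ⦃i j⦄, σ.Below i j → c i < c j) ↔
      ∀ (e : h.Edge) (i : I), IsMaximalNode c e.1 i ↔ i = σ.head e := by
  constructor
  · intro hc e i
    constructor
    · rintro ⟨hi, hmax⟩
      by_contra hne
      exact (hc ⟨e, rfl, by simp [hi, hne]⟩).not_ge (hmax _ (σ.2 e))
    · rintro rfl
      exact compatible_iff_forall_below_le.2 (fun i j hij => (hc hij).le) e
  · rintro hc i _ ⟨e, rfl, hi⟩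
    obtain ⟨hie, hne⟩ : i ∈ e.1 ∧ i ≠ σ.head e := by simpa using hi
    have head_max := (hc e _).2 rfl
    by_contra! hle
    exact hne ((hc e i).1 ⟨hie, fun j hj => (head_max.2 j hj).trans hle⟩)

end Heading

open Heading

variable {m : ℕ} {c : I → Fin m}

theorem isProperColoring_iff_exists_heading :
    h.IsProperColoring c ↔ ∃ σ : h.Heading, ∀ ⦃i j⦄, σ.Below i j → c i < c j := by
  simp only [forall_below_lt_iff_isMaximalNode_iff]
  constructor
  · intro hc
    have existsUnique_max (e : h.Edge) : ∃! i, IsMaximalNode c e.1 i := hc _ Multiset.coe_mem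
    choose f hf huniq using existsUnique_max
    exact ⟨⟨f, fun e => (hf e).1⟩, fun e i => ⟨huniq e i, by rintro rfl; exact hf e⟩⟩
  · rintro ⟨σ, hσ⟩ e he
    let e' : h.Edge := ⟨e, 0, Multiset.count_pos.2 he⟩
    exact ⟨σ.head e', (hσ e' _).2 rfl, fun i => (hσ e' i).1⟩

theorem Heading.eq_of_forall_below_lt {σ τ : h.Heading} (hσ : ∀ ⦃i j⦄, σ.Below i j → c i < c j)
    (hτ : ∀ ⦃i j⦄, τ.Below i j → c i < c j) : σ = τ := by
  rw [forall_below_lt_iff_isMaximalNode_iff] at hσ hτ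
  exact Subtype.ext <| funext fun e => (hτ e _).1 ((hσ e _).2 rfl)

theorem card_properColoring_eq_sum [Finite I] [Fintype {σ : h.Heading // σ.IsAcyclic}] (m : ℕ) :
    Nat.card {c : I → Fin m // h.IsProperColoring c} =
      ∑ σ : {σ : h.Heading // σ.IsAcyclic}, Nat.card (StrictLabeling σ.1.Below m) := by
  rw [← Nat.card_sigma]
  symm
  refine Nat.card_eq_of_bijective
    (fun p => ⟨p.2, isProperColoring_iff_exists_heading.2 ⟨p.1, fun _ _ => p.2.map_rel⟩⟩) ⟨?_, ?_⟩
  · rintro ⟨⟨σ, _⟩, c⟩ ⟨⟨τ, _⟩, d⟩ heq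
    have coe_eq : ⇑c = d := congrArg Subtype.val heq
    obtain rfl : σ = τ := eq_of_forall_below_lt (c := c) (fun _ _ => c.map_rel)
      (coe_eq ▸ fun _ _ => d.map_rel)
    obtain rfl : c = d := DFunLike.coe_injective coe_eq
    rfl
  · rintro ⟨c, hc⟩
    obtain ⟨σ, hσ⟩ := isProperColoring_iff_exists_heading.1 hc
    let d : StrictLabeling σ.Below m := ⟨c, fun hij => hσ hij⟩
    exact ⟨⟨⟨σ, isAcyclic_of_strictLabeling d⟩, d⟩, rfl⟩

theorem card_acyclic_compatible_eq_sum [Finite I] [Fintype {σ : h.Heading // σ.IsAcyclic}]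
    (m : ℕ) :
    Nat.card {p : h.Heading × (I → Fin m) // p.1.IsAcyclic ∧ Compatible p.1 p.2} =
      ∑ σ : {σ : h.Heading // σ.IsAcyclic}, Nat.card (WeakLabeling σ.1.Below m) := by
  rw [← Nat.card_sigma]
  exact Nat.card_congr
    { toFun p := ⟨⟨p.1.1, p.2.1⟩, p.1.2, fun hij => compatible_iff_forall_below_le.1 p.2.2 hij⟩
      invFun p :=
        ⟨(p.1.1, p.2), p.1.2, compatible_iff_forall_below_le.2 fun _ _ => p.2.map_rel⟩
      left_inv _ := rfl
      right_inv _ := rfl }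

theorem card_acyclic_compatible_one (h : MultiHypergraph I) :
    Nat.card {p : h.Heading × (I → Fin 1) // p.1.IsAcyclic ∧ Compatible p.1 p.2} =
      Nat.card {σ : h.Heading // σ.IsAcyclic} :=
  Nat.card_congr
    { toFun p := ⟨p.1.1, p.2.1⟩
      invFun σ := ⟨(σ.1, 0), σ.2, fun e => ⟨σ.1.2 e, fun _ _ => le_rfl⟩⟩
      left_inv _ := Subtype.ext (Prod.ext rfl (Subsingleton.elim _ _))
      right_inv _ := rfl }

theorem exists_isColoringPolynomial_and_reciprocity [Finite I] (h : MultiHypergraph I) :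
    ∃ χ : ℚ[X], h.IsColoringPolynomial χ ∧ ∀ m : ℕ,
      (-1 : ℚ) ^ Nat.card I * χ.eval (-(m : ℚ)) =
        Nat.card {p : h.Heading × (I → Fin m) // p.1.IsAcyclic ∧ Compatible p.1 p.2} := by
  have := Fintype.ofFinite {σ : h.Heading // σ.IsAcyclic}
  choose P hP using fun σ : {σ : h.Heading // σ.IsAcyclic} =>
    exists_orderPolynomial_reciprocity (isAcyclic_iff_wellFounded_below.1 σ.2)
  refine ⟨∑ σ, P σ, fun m _ => ?_, fun m => ?_⟩
  · rw [card_properColoring_eq_sum, Nat.cast_sum, eval_finsetSum]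
    exact sum_congr rfl fun σ _ => (hP σ m).1
  · rw [card_acyclic_compatible_eq_sum, Nat.cast_sum, eval_finsetSum, mul_sum]
    refine sum_congr rfl fun σ _ => ?_
    rw [(hP σ m).2, ← mul_assoc, ← mul_pow]
    simp

end MultiHypergraph

theorem mainTheorem4 {I : Type*} [Fintype I] [DecidableEq I] (h : MultiHypergraph I) :
    (∃! χ : ℚ[X], h.IsColoringPolynomial χ) ∧
    ∀ χ : ℚ[X], h.IsColoringPolynomial χ →
      (∀ m : ℕ, 0 < m →
        (-1 : ℚ) ^ Fintype.card I * χ.eval (-(m : ℚ)) =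
          (Nat.card {p : h.Heading × (I → Fin m) //
            p.1.IsAcyclic ∧ MultiHypergraph.Compatible p.1 p.2} : ℚ)) ∧
      (-1 : ℚ) ^ Fintype.card I * χ.eval (-1) =
        (Nat.card {σ : h.Heading // σ.IsAcyclic} : ℚ) := by
  obtain ⟨χ₀, hχ₀, reciprocity⟩ := h.exists_isColoringPolynomial_and_reciprocity
  rw [Nat.card_eq_fintype_card] at reciprocity
  refine ⟨⟨χ₀, hχ₀, fun χ hχ => hχ.eq hχ₀⟩, fun χ hχ => ?_⟩
  obtain rfl := hχ.eq hχ₀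
  refine ⟨fun m _ => reciprocity m, ?_⟩
  rw [← h.card_acyclic_compatible_one, ← reciprocity 1, Nat.cast_one]
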